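/- **Theorem (Characterization Theorem).** Let $V \neq \{0\}$ be a (Hausdorff) real locally convex space, let $\omega : V \times V \to \mathbb{R}$ be a continuous non-degenerate alternating bilinear form, and let $\gamma : \mathbb{R} \to \mathrm{Sp}(V,\omega)$ be a one-parameter group of continuous linear $\omega$-preserving maps for which the action $\mathbb{R} \times V \to V$, $(t,v) \mapsto \gamma(t)v$, is smooth (in the sense of calculus on locally convex spaces: all iterated directional derivatives exist and are continuous). Let $D := \gamma'(0) : V \to V$ be its infinitesimal generator. Let $G = G(V,\omega,\gamma)$ be the oscillator group, i.e. $\mathbb{R} \times V \times \mathbb{R}$ with the multiplication $$(z,v,t)(z',v',t') = \big(z+z'+\tfrac12 \omega(v,\gamma(t)v'),\ v+\gamma(t)v',\ t+t'\big),$$ and let $\mathfrak{g} = \mathfrak{g}(V,\omega,D) = \mathbb{R} \times V \times \mathbb{R}$ be its Lie algebra, with bracket $[(z,v,t),(z',v',t')] = (\omega(v,v'),\, tDv'-t'Dv,\, 0)$. The group $G$ acts on the topological dual $\mathfrak{g}'$ by $\mathrm{Ad}^*(g)\lambda = \lambda \circ \mathrm{Ad}(g)^{-1}$, with coadjoint orbits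 $\mathcal{O}_\lambda = \mathrm{Ad}^*(G)\lambda$; an orbit is called non-trivial if it has more than one point. A subset $E \subseteq \mathfrak{g}'$ is called semi-equicontinuous if its support functional $s_E(x) = \sup_{\alpha \in E} \alpha(-x)$ is bounded on a neighborhood of some point of $\mathfrak{g}$. Then $\mathfrak{g}(V,\omega,D)$ has a non-trivial semi-equicontinuous coadjoint orbit if and only if the following conditions hold for $D$, or hold with $D$ replaced by $-D$: - (C1) The form $Q(x,y) := \omega(Dx,y)$ is a positive definite symmetric bilinear form on $V$. - (C2) For every $x \in V$ the functional $i_x\omega = \omega(x,\cdot)$ is continuous with respect to the norm $y \mapsto Q(y,y)^{1/2}$. - (C3) Let $V_Q$ be the Hilbert completion of $(V,Q)$. The map $\eta : V \to V_Q$ defined by $Q(\eta(x),y) = \omega(x,y)$ for all $x,y \in V$ is continuous from $V$, with its given locally convex topology, to $V_Q$. -/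

import Mathlib

open Filter Topology

noncomputable section

universe u v

namespace Oscillator

/-! ### Calculus in locally convex spaces -/

/-- `f` is of class `C^n` in the sense of Bastiani (Michal--Bastiani, Keller's `C^n_c`):
`f` is continuous and, for `n ≥ 1`, all directional derivatives `df (x, h)` exist and
`df : E × E → F` is of class `C^(n-1)`. -/
def IsBastiani {F : Type v} [AddCommGroup F] [Module ℝ F] [TopologicalSpace F] :
    ℕ → ∀ {E : Type u} [AddCommGroup E] [Module ℝ E] [TopologicalSpace E], (E → F) → Prop
  | 0, _, _, _, _, f => Continuous f
  | n + 1, E, _, _, _, f => Continuous f ∧ ∃ df : E × E → F,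
      (∀ x h : E, Tendsto (fun s : ℝ => s⁻¹ • (f (x + s • h) - f x)) (𝓝[≠] 0) (𝓝 (df (x, h)))) ∧
      IsBastiani n df

/-- Smooth maps between locally convex spaces. -/
def IsSmooth {E : Type u} {F : Type v} [AddCommGroup E] [Module ℝ E] [TopologicalSpace E]
    [AddCommGroup F] [Module ℝ F] [TopologicalSpace F] (f : E → F) : Prop :=
  ∀ n : ℕ, IsBastiani n f

/-- The derivative at `s = 0` of a curve with values in a topological vector space. -/
def velocity {F : Type v} [AddCommGroup F] [Module ℝ F] [TopologicalSpace F] (c : ℝ → F) : F :=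
  limUnder (𝓝[≠] (0 : ℝ)) (fun s : ℝ => s⁻¹ • (c s - c 0))

/-! ### The data: a locally convex symplectic space with a smooth one-parameter group -/

/-- A continuous symplectic form `ω` on `V` and a one-parameter group
`γ : ℝ → Sp(V, ω)` defining a smooth action of `ℝ` on `V`. -/
structure Datum (V : Type u) [AddCommGroup V] [Module ℝ V] [TopologicalSpace V] where
  ω : V →ₗ[ℝ] V →ₗ[ℝ] ℝ
  continuous_ω : Continuous fun p : V × V => ω p.1 p.2
  isAlt_ω : ω.IsAlt
  nondegenerate_ω : ω.Nondegenerate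
  γ : ℝ → V →L[ℝ] V
  γ_zero : γ 0 = ContinuousLinearMap.id ℝ V
  γ_add : ∀ s t : ℝ, γ (s + t) = (γ s).comp (γ t)
  γ_symp : ∀ (t : ℝ) (x y : V), ω (γ t x) (γ t y) = ω x y
  γ_smooth : IsSmooth fun p : ℝ × V => γ p.1 p.2

variable {V : Type u} [AddCommGroup V] [Module ℝ V] [TopologicalSpace V]

namespace Datum

theorem ω_self (S : Datum V) (x : V) : S.ω x x = 0 := S.isAlt_ω x

theorem ω_swap (S : Datum V) (x y : V) : S.ω x y = -S.ω y x := (S.isAlt_ω.neg y x).symm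

theorem γ_zero_apply (S : Datum V) (x : V) : S.γ 0 x = x := by simp [S.γ_zero]

theorem γ_add_apply (S : Datum V) (s t : ℝ) (x : V) : S.γ (s + t) x = S.γ s (S.γ t x) := by
  simp [S.γ_add]

theorem γ_neg_cancel (S : Datum V) (t : ℝ) (x : V) : S.γ t (S.γ (-t) x) = x := by
  rw [← S.γ_add_apply, add_neg_cancel, S.γ_zero_apply]

theorem γ_cancel_neg (S : Datum V) (t : ℝ) (x : V) : S.γ (-t) (S.γ t x) = x := by
  rw [← S.γ_add_apply, neg_add_cancel, S.γ_zero_apply]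

/-- The infinitesimal generator `D = γ'(0)`, as a function. -/
def genFun (S : Datum V) (x : V) : V := velocity fun t => S.γ t x

theorem exists_df (S : Datum V) : ∃ df : (ℝ × V) × (ℝ × V) → V, Continuous df ∧
    ∀ (x : V) (a : ℝ), Tendsto (fun s : ℝ => s⁻¹ • (S.γ (s * a) x - x)) (𝓝[≠] 0)
      (𝓝 (df ((0, x), (a, 0)))) := by
  obtain ⟨-, df, hdf, hc⟩ := S.γ_smooth 1
  refine ⟨df, hc, fun x a => ?_⟩
  simpa [S.γ_zero_apply] using hdf (0, x) (a, 0)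

theorem continuous_action (S : Datum V) : Continuous fun p : ℝ × V => S.γ p.1 p.2 := S.γ_smooth 0

theorem tendsto_gen [T2Space V] (S : Datum V) (x : V) :
    Tendsto (fun s : ℝ => s⁻¹ • (S.γ s x - x)) (𝓝[≠] 0) (𝓝 (S.genFun x)) := by
  obtain ⟨df, -, hdf⟩ := S.exists_df
  have h := hdf x 1
  simp only [mul_one] at h
  have h' : Tendsto (fun s : ℝ => s⁻¹ • (S.γ s x - S.γ 0 x)) (𝓝[≠] 0)
      (𝓝 (df ((0, x), (1, 0)))) := by simpa [S.γ_zero_apply] using h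
  have e : S.genFun x = df ((0, x), (1, 0)) := h'.limUnder_eq
  rw [e]
  exact h

theorem tendsto_action (S : Datum V) (x : V) (a : ℝ) :
    Tendsto (fun s : ℝ => S.γ (s * a) x) (𝓝[≠] 0) (𝓝 x) := by
  have h : Continuous fun s : ℝ => S.γ (s * a) x :=
    S.continuous_action.comp (f := fun s : ℝ => (s * a, x)) (by fun_prop)
  have := h.tendsto 0
  rw [zero_mul, S.γ_zero_apply] at this
  exact this.mono_left nhdsWithin_le_nhds

theorem tendsto_ω (S : Datum V) {f g : ℝ → V} {l : Filter ℝ} {x y : V}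
    (hf : Tendsto f l (𝓝 x)) (hg : Tendsto g l (𝓝 y)) :
    Tendsto (fun s => S.ω (f s) (g s)) l (𝓝 (S.ω x y)) :=
  (S.continuous_ω.tendsto (x, y)).comp (hf.prodMk_nhds hg)

variable [IsTopologicalAddGroup V] [ContinuousSMul ℝ V] [T2Space V]

/-- The infinitesimal generator `D = γ'(0)` as a continuous linear operator. -/
def D (S : Datum V) : V →L[ℝ] V where
  toFun := S.genFun
  map_add' x y := by
    refine tendsto_nhds_unique (S.tendsto_gen (x + y))
      (((S.tendsto_gen x).add (S.tendsto_gen y)).congr fun s => ?_)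
    rw [map_add, ← smul_add]
    congr 1
    abel
  map_smul' c x := by
    refine tendsto_nhds_unique (S.tendsto_gen (c • x))
      (((S.tendsto_gen x).const_smul c).congr fun s => ?_)
    rw [map_smul, smul_comm, smul_sub]
  cont := by
    obtain ⟨df, hc, hdf⟩ := S.exists_df
    have e : S.genFun = fun x => df ((0, x), (1, 0)) := by
      funext x
      have h := hdf x 1
      simp only [mul_one] at h
      exact tendsto_nhds_unique (S.tendsto_gen x) h
    rw [e]
    exact hc.comp (by fun_prop)

theorem tendsto_D (S : Datum V) (x : V) :
    Tendsto (fun s : ℝ => s⁻¹ • (S.γ s x - x)) (𝓝[≠] 0) (𝓝 (S.D x)) := S.tendsto_gen x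

theorem tendsto_D_mul (S : Datum V) (x : V) (a : ℝ) :
    Tendsto (fun s : ℝ => s⁻¹ • (S.γ (s * a) x - x)) (𝓝[≠] 0) (𝓝 (a • S.D x)) := by
  rcases eq_or_ne a 0 with rfl | ha
  · simp [S.γ_zero_apply]
  · have h1 : Tendsto (fun s : ℝ => s * a) (𝓝[≠] 0) (𝓝[≠] 0) := by
      refine tendsto_nhdsWithin_iff.2 ⟨?_, ?_⟩
      · have : Tendsto (fun s : ℝ => s * a) (𝓝 0) (𝓝 (0 * a)) :=
          (continuous_mul_const a).tendsto 0
        rw [zero_mul] at this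
        exact this.mono_left nhdsWithin_le_nhds
      · filter_upwards [self_mem_nhdsWithin] with s hs
        exact mul_ne_zero hs ha
    refine (((S.tendsto_D x).comp h1).const_smul a).congr fun s => ?_
    simp only [Function.comp_apply]
    rw [smul_smul, mul_inv, mul_left_comm, mul_inv_cancel₀ ha, mul_one]

/-- `D` is skew with respect to `ω`. -/
theorem ω_D_left (S : Datum V) (x y : V) : S.ω (S.D x) y = -S.ω x (S.D y) := by
  have h1 := S.tendsto_ω (S.tendsto_D x) (by simpa using S.tendsto_action y 1)
  have h2 := S.tendsto_ω (tendsto_const_nhds (x := x)) (S.tendsto_D y)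
  have h3 := tendsto_nhds_unique (h1.add h2)
    ((tendsto_const_nhds (x := (0 : ℝ))).congr fun s => ?_)
  · linarith
  · simp only [map_smul, map_sub, LinearMap.smul_apply, LinearMap.sub_apply, smul_eq_mul,
      S.γ_symp]
    ring

end Datum

/-! ### The oscillator group -/

/-- The generalized oscillator group `G(V, ω, γ) = Heis(V, ω) ⋊_γ ℝ`. -/
@[ext] structure OscGroup (S : Datum V) where
  z : ℝ
  v : V
  t : ℝ

namespace OscGroup

variable {S : Datum V}

instance : Mul (OscGroup S) where
  mul g h := ⟨g.z + h.z + (1 / 2) * S.ω g.v (S.γ g.t h.v), g.v + S.γ g.t h.v, g.t + h.t⟩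

instance : One (OscGroup S) where
  one := ⟨0, 0, 0⟩

instance : Inv (OscGroup S) where
  inv g := ⟨-g.z, -S.γ (-g.t) g.v, -g.t⟩

theorem mul_def (g h : OscGroup S) :
    g * h = ⟨g.z + h.z + (1 / 2) * S.ω g.v (S.γ g.t h.v), g.v + S.γ g.t h.v, g.t + h.t⟩ := rfl

theorem one_def : (1 : OscGroup S) = ⟨0, 0, 0⟩ := rfl

theorem inv_def (g : OscGroup S) : g⁻¹ = ⟨-g.z, -S.γ (-g.t) g.v, -g.t⟩ := rfl

instance : Group (OscGroup S) :=
  Group.ofLeftAxioms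
    (fun a b c => by
      simp only [mul_def, map_add, S.γ_add_apply, LinearMap.add_apply, OscGroup.mk.injEq, S.γ_symp]
      refine ⟨by ring, by abel, by ring⟩)
    (fun a => by simp [mul_def, one_def, S.γ_zero_apply])
    (fun a => by simp [mul_def, one_def, inv_def, S.ω_self])

end OscGroup

/-! ### The oscillator algebra -/

/-- The oscillator algebra `𝔤(V, ω, D) = 𝔥𝔢𝔦𝔰(V, ω) ⋊_D ℝ`; as a topological vector space it is
`ℝ × V × ℝ`. -/
def OscAlgebra (_S : Datum V) : Type u := ℝ × V × ℝ

namespace OscAlgebra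

variable (S : Datum V)

instance : AddCommGroup (OscAlgebra S) := inferInstanceAs (AddCommGroup (ℝ × V × ℝ))
instance : Module ℝ (OscAlgebra S) := inferInstanceAs (Module ℝ (ℝ × V × ℝ))
instance : TopologicalSpace (OscAlgebra S) := inferInstanceAs (TopologicalSpace (ℝ × V × ℝ))
instance [IsTopologicalAddGroup V] : IsTopologicalAddGroup (OscAlgebra S) :=
  inferInstanceAs (IsTopologicalAddGroup (ℝ × V × ℝ))
instance [ContinuousSMul ℝ V] : ContinuousSMul ℝ (OscAlgebra S) :=
  inferInstanceAs (ContinuousSMul ℝ (ℝ × V × ℝ))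
instance [T2Space V] : T2Space (OscAlgebra S) := inferInstanceAs (T2Space (ℝ × V × ℝ))

variable {S}

/-- The element `(z, v, t)`. -/
def mk (z : ℝ) (v : V) (t : ℝ) : OscAlgebra S := (z, v, t)

def z (x : OscAlgebra S) : ℝ := x.1
def v (x : OscAlgebra S) : V := x.2.1
def t (x : OscAlgebra S) : ℝ := x.2.2

@[ext] theorem ext' {x y : OscAlgebra S} (h1 : x.z = y.z) (h2 : x.v = y.v) (h3 : x.t = y.t) :
    x = y := Prod.ext h1 (Prod.ext h2 h3)

@[simp] theorem z_mk (a : ℝ) (b : V) (c : ℝ) : (mk a b c : OscAlgebra S).z = a := rfl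
@[simp] theorem v_mk (a : ℝ) (b : V) (c : ℝ) : (mk a b c : OscAlgebra S).v = b := rfl
@[simp] theorem t_mk (a : ℝ) (b : V) (c : ℝ) : (mk a b c : OscAlgebra S).t = c := rfl
@[simp] theorem z_add (x y : OscAlgebra S) : (x + y).z = x.z + y.z := rfl
@[simp] theorem v_add (x y : OscAlgebra S) : (x + y).v = x.v + y.v := rfl
@[simp] theorem t_add (x y : OscAlgebra S) : (x + y).t = x.t + y.t := rfl
@[simp] theorem z_smul (c : ℝ) (x : OscAlgebra S) : (c • x).z = c * x.z := rfl
@[simp] theorem v_smul (c : ℝ) (x : OscAlgebra S) : (c • x).v = c • x.v := rfl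
@[simp] theorem t_smul (c : ℝ) (x : OscAlgebra S) : (c • x).t = c * x.t := rfl
@[simp] theorem z_zero : (0 : OscAlgebra S).z = 0 := rfl
@[simp] theorem v_zero : (0 : OscAlgebra S).v = 0 := rfl
@[simp] theorem t_zero : (0 : OscAlgebra S).t = 0 := rfl

theorem continuous_z : Continuous (z : OscAlgebra S → ℝ) := continuous_fst
theorem continuous_v : Continuous (v : OscAlgebra S → V) := continuous_fst.comp continuous_snd
theorem continuous_t : Continuous (t : OscAlgebra S → ℝ) := continuous_snd.comp continuous_snd
theorem continuous_mk {X : Type*} [TopologicalSpace X] {a c : X → ℝ} {b : X → V}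
    (ha : Continuous a) (hb : Continuous b) (hc : Continuous c) :
    Continuous fun x => (mk (a x) (b x) (c x) : OscAlgebra S) :=
  ha.prodMk (hb.prodMk hc)
theorem tendsto_mk {X : Type*} {l : Filter X} {a c : X → ℝ} {b : X → V} {a₀ c₀ : ℝ} {b₀ : V}
    (ha : Tendsto a l (𝓝 a₀)) (hb : Tendsto b l (𝓝 b₀)) (hc : Tendsto c l (𝓝 c₀)) :
    Tendsto (fun x => (mk (a x) (b x) (c x) : OscAlgebra S)) l (𝓝 (mk a₀ b₀ c₀)) :=
  ha.prodMk_nhds (hb.prodMk_nhds hc)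

variable [IsTopologicalAddGroup V] [ContinuousSMul ℝ V] [T2Space V]

instance : LieRing (OscAlgebra S) where
  bracket x y := mk (S.ω x.v y.v) (x.t • S.D y.v - y.t • S.D x.v) 0
  add_lie x y w := by
    ext <;> simp [add_smul]
    abel
  lie_add x y w := by
    ext <;> simp [add_smul]
    abel
  lie_self x := by ext <;> simp [S.ω_self]
  leibniz_lie x y w := by
    ext
    · simp only [z_mk, v_mk, map_sub, map_smul, LinearMap.sub_apply, LinearMap.smul_apply,
        smul_eq_mul, z_add, S.ω_D_left]
      rw [S.ω_swap y.v (S.D x.v), S.ω_D_left x.v y.v]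
      ring
    · simp only [v_mk, t_mk, v_add, map_sub, map_smul, zero_smul, smul_sub, smul_smul]
      rw [mul_comm x.t y.t, mul_comm x.t w.t, mul_comm y.t w.t]
      abel
    · simp

instance : LieAlgebra ℝ (OscAlgebra S) where
  lie_smul c x y := by
    change mk _ _ _ = c • mk _ _ _
    ext <;> simp [smul_sub, smul_smul, mul_comm]

end OscAlgebra

/-! ### Adjoint and coadjoint action -/

section Adjoint

variable {S : Datum V}

/-- The global chart `G → ℝ × V × ℝ` of the oscillator group, which identifies the tangent space
at the identity `(0, 0, 0)` with the oscillator algebra. -/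
def chart (S : Datum V) : OscGroup S ≃ OscAlgebra S where
  toFun g := OscAlgebra.mk g.z g.v g.t
  invFun x := ⟨x.z, x.v, x.t⟩
  left_inv _ := rfl
  right_inv _ := rfl

theorem chart_apply (g : OscGroup S) : chart S g = OscAlgebra.mk g.z g.v g.t := rfl

theorem chart_symm_apply (x : OscAlgebra S) : (chart S).symm x = ⟨x.z, x.v, x.t⟩ := rfl

/-- `Ad(g) x`: the derivative at the identity, in the direction `x`, of the conjugation
`h ↦ g h g⁻¹`. -/
def adFun (g : OscGroup S) (x : OscAlgebra S) : OscAlgebra S :=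
  velocity fun s : ℝ => chart S (g * (chart S).symm (s • x) * g⁻¹)

variable [IsTopologicalAddGroup V] [ContinuousSMul ℝ V] [T2Space V]

theorem tendsto_adFun (g : OscGroup S) (x : OscAlgebra S) :
    Tendsto (fun s : ℝ => s⁻¹ • (chart S (g * (chart S).symm (s • x) * g⁻¹) -
        chart S (g * (chart S).symm ((0 : ℝ) • x) * g⁻¹))) (𝓝[≠] 0)
      (𝓝 (OscAlgebra.mk (x.z + S.ω g.v (S.γ g.t x.v) + (1 / 2) * x.t * S.ω (S.D g.v) g.v)
        (S.γ g.t x.v - x.t • S.D g.v) x.t)) := by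
  have hA := S.tendsto_D_mul g.v x.t
  have hB := S.tendsto_action g.v x.t
  have h1 := S.tendsto_ω (tendsto_const_nhds (x := g.v)) hA
  have h2 := S.tendsto_ω (tendsto_const_nhds (x := S.γ g.t x.v)) hB
  have hz := ((tendsto_const_nhds (x := x.z + (1 / 2) * S.ω g.v (S.γ g.t x.v))).sub
    (h1.const_mul (1 / 2))).sub (h2.const_mul (1 / 2))
  have hv := (tendsto_const_nhds (x := S.γ g.t x.v)).sub hA
  have key := OscAlgebra.tendsto_mk (S := S) hz hv (tendsto_const_nhds (x := x.t))
  have e : (OscAlgebra.mk (x.z + S.ω g.v (S.γ g.t x.v) + (1 / 2) * x.t * S.ω (S.D g.v) g.v)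
        (S.γ g.t x.v - x.t • S.D g.v) x.t : OscAlgebra S) =
      OscAlgebra.mk (x.z + 1 / 2 * S.ω g.v (S.γ g.t x.v) - 1 / 2 * S.ω g.v (x.t • S.D g.v) -
        1 / 2 * S.ω (S.γ g.t x.v) g.v) (S.γ g.t x.v - x.t • S.D g.v) x.t := by
    congr 1
    rw [S.ω_swap (S.γ g.t x.v) g.v, S.ω_swap (S.D g.v) g.v, map_smul, smul_eq_mul]
    ring
  rw [e]
  refine key.congr' ?_
  filter_upwards [self_mem_nhdsWithin] with s hs
  have hs : s ≠ 0 := hs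
  have h0 : chart S (g * (chart S).symm ((0 : ℝ) • x) * g⁻¹) = 0 := by
    have : (chart S).symm ((0 : ℝ) • x) = 1 := by
      rw [zero_smul]
      rfl
    rw [this, mul_one, mul_inv_cancel]
    rfl
  have hγ : S.γ (g.t + s * x.t) (S.γ (-g.t) g.v) = S.γ (s * x.t) g.v := by
    rw [add_comm, S.γ_add_apply, S.γ_neg_cancel]
  rw [h0, sub_zero]
  simp only [OscGroup.mul_def, OscGroup.inv_def, chart_apply, chart_symm_apply,
    OscAlgebra.z_smul, OscAlgebra.v_smul, OscAlgebra.t_smul, map_neg, map_smul, hγ]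
  ext
  · simp only [OscAlgebra.z_mk, OscAlgebra.z_smul, map_add, map_smul, map_sub, LinearMap.add_apply,
      LinearMap.smul_apply, smul_eq_mul, S.ω_self]
    field_simp
    ring
  · simp only [OscAlgebra.v_mk, OscAlgebra.v_smul, smul_add, smul_sub, smul_neg]
    rw [smul_smul, inv_mul_cancel₀ hs, one_smul]
    abel
  · simp only [OscAlgebra.t_mk, OscAlgebra.t_smul]
    field_simp
    ring

theorem adFun_apply (g : OscGroup S) (x : OscAlgebra S) :
    adFun g x = OscAlgebra.mk (x.z + S.ω g.v (S.γ g.t x.v) + (1 / 2) * x.t * S.ω (S.D g.v) g.v)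
        (S.γ g.t x.v - x.t • S.D g.v) x.t :=
  (tendsto_adFun g x).limUnder_eq

/-- The adjoint action as a continuous linear map. -/
def Ad (g : OscGroup S) : OscAlgebra S →L[ℝ] OscAlgebra S where
  toFun := adFun g
  map_add' x y := by
    simp only [adFun_apply]
    ext
    · simp only [OscAlgebra.z_mk, OscAlgebra.z_add, OscAlgebra.v_add, OscAlgebra.t_add, map_add]
      ring
    · simp only [OscAlgebra.v_mk, OscAlgebra.v_add, OscAlgebra.t_add, map_add, add_smul]
      abel
    · simp
  map_smul' c x := by
    simp only [adFun_apply, RingHom.id_apply]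
    ext
    · simp only [OscAlgebra.z_mk, OscAlgebra.z_smul, OscAlgebra.v_smul, OscAlgebra.t_smul, map_smul,
        smul_eq_mul]
      ring
    · simp [smul_sub, smul_smul]
    · simp
  cont := by
    have e : adFun g = fun x : OscAlgebra S =>
        OscAlgebra.mk (x.z + S.ω g.v (S.γ g.t x.v) + (1 / 2) * x.t * S.ω (S.D g.v) g.v)
        (S.γ g.t x.v - x.t • S.D g.v) x.t := funext (adFun_apply g)
    have hω : Continuous fun x : OscAlgebra S => S.ω g.v (S.γ g.t x.v) :=
      S.continuous_ω.comp (continuous_const.prodMk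
        ((S.γ g.t).continuous.comp OscAlgebra.continuous_v))
    rw [e]
    exact OscAlgebra.continuous_mk
      ((OscAlgebra.continuous_z.add hω).add
        ((continuous_const.mul OscAlgebra.continuous_t).mul continuous_const))
      (((S.γ g.t).continuous.comp OscAlgebra.continuous_v).sub
        (OscAlgebra.continuous_t.smul continuous_const))
      OscAlgebra.continuous_t

theorem Ad_apply (g : OscGroup S) (x : OscAlgebra S) :
    Ad g x = OscAlgebra.mk (x.z + S.ω g.v (S.γ g.t x.v) + (1 / 2) * x.t * S.ω (S.D g.v) g.v)
        (S.γ g.t x.v - x.t • S.D g.v) x.t := adFun_apply g x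

/-- The coadjoint action `Ad*(g) α = α ∘ Ad(g)⁻¹` on the topological dual. -/
def coAd (g : OscGroup S) (α : OscAlgebra S →L[ℝ] ℝ) : OscAlgebra S →L[ℝ] ℝ := α.comp (Ad g⁻¹)

/-- The coadjoint orbit `{Ad*(g) α : g ∈ G}`. -/
def coadjointOrbit (α : OscAlgebra S →L[ℝ] ℝ) : Set (OscAlgebra S →L[ℝ] ℝ) :=
  Set.range fun g : OscGroup S => coAd g α

end Adjoint

/-! ### Semi-equicontinuous sets -/

/-- The support functional `s_E(x) = sup ⟨E, -x⟩`. -/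
def supportFunctional {E : Type u} [AddCommGroup E] [Module ℝ E] [TopologicalSpace E]
    (A : Set (E →L[ℝ] ℝ)) (x : E) : EReal :=
  ⨆ α ∈ A, ((α (-x) : ℝ) : EReal)

/-- `A` is semi-equicontinuous if its support functional is bounded (from above) on a neighborhood
of some point. If `A` is non-empty, `s_A` is bounded below near every point by a continuous linear
functional, so that a bound from above is the only condition. -/
def SemiEquicontinuous {E : Type u} [AddCommGroup E] [Module ℝ E] [TopologicalSpace E]
    (A : Set (E →L[ℝ] ℝ)) : Prop :=
  ∃ x₀ : E, ∃ U ∈ 𝓝 x₀, ∃ C : ℝ, ∀ x ∈ U, supportFunctional A x ≤ (C : EReal)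

/-! ### Euclidean forms and their Hilbert completions -/

/-- A positive definite symmetric bilinear form. -/
def IsPosDef (Q : V →ₗ[ℝ] V →ₗ[ℝ] ℝ) : Prop :=
  (∀ x y, Q x y = Q y x) ∧ ∀ x, x ≠ 0 → 0 < Q x x

/-- The space `V` with the inner product `Q` and the norm topology of `Q` (the given topology of
`V` is forgotten). -/
def FormSpace (Q : V →ₗ[ℝ] V →ₗ[ℝ] ℝ) (_hQ : IsPosDef Q) : Type u := V

namespace FormSpace

variable (Q : V →ₗ[ℝ] V →ₗ[ℝ] ℝ) (hQ : IsPosDef Q)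

instance : AddCommGroup (FormSpace Q hQ) := inferInstanceAs (AddCommGroup V)
instance : Module ℝ (FormSpace Q hQ) := inferInstanceAs (Module ℝ V)

/-- The identity map from `V` to `V` with the inner product `Q`. -/
def of : V ≃ₗ[ℝ] FormSpace Q hQ := LinearEquiv.refl ℝ V

@[reducible] def core : InnerProductSpace.Core ℝ (FormSpace Q hQ) where
  inner x y := Q ((of Q hQ).symm x) ((of Q hQ).symm y)
  conj_inner_symm x y := hQ.1 _ _
  re_inner_nonneg x := by
    rcases eq_or_ne ((of Q hQ).symm x) 0 with h | h
    · simp [h]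
    · exact (hQ.2 _ h).le
  add_left x y w := by simp
  smul_left x y r := by simp
  definite x h := by
    by_contra hx
    have h0 : (of Q hQ).symm x ≠ 0 := by simpa using hx
    exact (hQ.2 _ h0).ne' h

instance : NormedAddCommGroup (FormSpace Q hQ) := (core Q hQ).toNormedAddCommGroup
instance : InnerProductSpace ℝ (FormSpace Q hQ) := InnerProductSpace.ofCore (core Q hQ).toCore



/-- The Hilbert completion `V_Q`. -/
abbrev HilbertCompletion : Type u := UniformSpace.Completion (FormSpace Q hQ)

/-- The canonical embedding of `V` into `V_Q`. -/
def toCompletion (x : V) : HilbertCompletion Q hQ := ((of Q hQ x : FormSpace Q hQ) : HilbertCompletion Q hQ)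

end FormSpace

/-- The bilinear form `Q(x, y) = ω(D x, y)`. -/
def energyForm (ω : V →ₗ[ℝ] V →ₗ[ℝ] ℝ) (D : V →L[ℝ] V) : V →ₗ[ℝ] V →ₗ[ℝ] ℝ :=
  ω.comp (D : V →ₗ[ℝ] V)

/-- The conditions (C1), (C2), (C3) on a form `ω` and an operator `D`. The map `η` in (C3) is
uniquely determined by its defining identity, because `V` is dense in `V_Q`. -/
structure CharConditions (ω : V →ₗ[ℝ] V →ₗ[ℝ] ℝ) (D : V →L[ℝ] V) : Prop where
  /-- `Q(x, y) = ω(D x, y)` is positive definite. -/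
  c1 : IsPosDef (energyForm ω D)
  /-- Every functional `i_x ω = ω(x, ·)` is continuous for the norm topology of `Q`. -/
  c2 : ∀ x : V, Continuous fun y : FormSpace (energyForm ω D) c1 =>
    ω x ((FormSpace.of (energyForm ω D) c1).symm y)
  /-- The map `η : V → V_Q` with `Q(η x, y) = ω(x, y)` is continuous for the given topology
  of `V`. -/
  c3 : ∃ η : V → FormSpace.HilbertCompletion (energyForm ω D) c1,
    (∀ x y : V, inner ℝ (η x) (FormSpace.toCompletion (energyForm ω D) c1 y) = ω x y) ∧
      Continuous η

end Oscillator

end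

/-! Along the Heisenberg elements `g = (0, r • w, 0)`, the number `-α (Ad g x)` is a quadratic
polynomial in `r`, with leading coefficient `-(1/2) * x.t * c * ω (D w) w`, where `c = α (1, 0, 0)`.
If it is bounded above for all `r` and all `x` in an open set, a discriminant inequality follows.
Moving the `V`-component of `x` by small `n` and subtracting two instances isolates `ω w n` and
gives `ω w n ^ 2 ≤ K * (± ω (D w) w)`, uniformly for `n` in a zero neighborhood
(`exists_sq_le_of_semiEquicontinuous`). Here `c ≠ 0`, since otherwise the orbit is a point
(`not_nontrivial_coadjointOrbit`), and the sign of `x.t / c` decides between `D` and `-D`. This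
single bound contains all three conditions (`charConditions_of_bound`): positivity by nondegeneracy,
the other two as pointwise boundedness and equicontinuity of the functionals `i_n ω`.

Conversely, the orbit of the projection onto the center works. With `q` the `Q`-norm of `γ(-t) v`
for `g = (z, v, t)`, the Heisenberg term is at most `‖η x.v‖ * q` and the energy term is a negative
multiple of `q ^ 2`; hence the supremum is finite, locally uniformly
(`semiEquicontinuous_orbit_centralFunctional`). -/

namespace Oscillator

/-! ### The completion of a Euclidean form, and the three conditions from one uniform bound. -/

section Form

variable {V : Type*} [AddCommGroup V] [Module ℝ V]

theorem FormSpace.norm_sq (Q : V →ₗ[ℝ] V →ₗ[ℝ] ℝ) (hQ : IsPosDef Q) (x : V) :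
    ‖of Q hQ x‖ ^ 2 = Q x x :=
  (real_inner_self_eq_norm_sq (of Q hQ x)).symm

theorem FormSpace.norm_toCompletion_sq (Q : V →ₗ[ℝ] V →ₗ[ℝ] ℝ) (hQ : IsPosDef Q) (x : V) :
    ‖toCompletion Q hQ x‖ ^ 2 = Q x x := by
  rw [toCompletion, UniformSpace.Completion.norm_coe, norm_sq]

/-- A vector of the completion is bounded in norm by any bound for its inner products
with the elements of `V`. -/
theorem FormSpace.norm_le_of_inner_le (Q : V →ₗ[ℝ] V →ₗ[ℝ] ℝ) (hQ : IsPosDef Q)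
    (u : HilbertCompletion Q hQ) {r : ℝ} (hr : 0 ≤ r)
    (h : ∀ y : V, inner ℝ u (toCompletion Q hQ y) ≤ r * ‖toCompletion Q hQ y‖) : ‖u‖ ≤ r := by
  -- The bound extends by density to the whole completion, where it can be tested on `u` itself.
  have key : ∀ y : HilbertCompletion Q hQ, inner ℝ u y ≤ r * ‖y‖ := by
    intro y
    induction y using UniformSpace.Completion.induction_on with
    | hp => exact isClosed_le (by fun_prop) (by fun_prop)
    | ih y => exact h y
  rcases (norm_nonneg u).eq_or_lt with h0 | h0
  · exact h0 ▸ hr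
  · have h1 := key u
    rw [real_inner_self_eq_norm_sq] at h1
    nlinarith

variable [TopologicalSpace V] [IsTopologicalAddGroup V] [ContinuousSMul ℝ V]

/-- A bound of `i_n ω` in the norm of `Q = ω(D ·, ·)`, uniform for `n` in a zero neighborhood,
gives the three conditions. -/
theorem charConditions_of_bound (ω : V →ₗ[ℝ] V →ₗ[ℝ] ℝ) (D : V →L[ℝ] V) (halt : ω.IsAlt)
    (hnd : ω.Nondegenerate) (hD : ∀ x y, ω (D x) y = -ω x (D y)) {N : Set V} (hN : N ∈ 𝓝 0)
    {K : ℝ} (hK : 0 < K) (h : ∀ n ∈ N, ∀ w, ω w n ^ 2 ≤ K * ω (D w) w) :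
    CharConditions ω D := by
  have habs : ∀ x : V, ∃ r : ℝ, 0 < r ∧ r • x ∈ N := by
    intro x
    have hc : Tendsto (fun r : ℝ => r • x) (𝓝[>] 0) (𝓝 0) := by
      have : Continuous fun r : ℝ => r • x := by fun_prop
      simpa using (this.tendsto 0).mono_left (nhdsWithin_le_nhds (s := Set.Ioi 0))
    obtain ⟨r, hr, hr'⟩ := ((hc.eventually hN).and self_mem_nhdsWithin).exists
    exact ⟨r, hr', hr⟩
  have c1 : IsPosDef (energyForm ω D) := by
    refine ⟨fun x y => ?_, fun w hw => ?_⟩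
    · change ω (D x) y = ω (D y) x
      rw [hD, halt.neg]
    -- Nondegeneracy provides `y` with `ω w y ≠ 0`; scaled into `N`, it makes the left side of `h`
    -- positive.
    · have : ∃ y, ω w y ≠ 0 := by
        by_contra! hy
        exact hw (hnd.1 w hy)
      obtain ⟨y, hy⟩ := this
      obtain ⟨r, hr, hrN⟩ := habs y
      have h1 := h _ hrN w
      rw [map_smul, smul_eq_mul] at h1
      have h2 : 0 < (r * ω w y) ^ 2 := by positivity
      exact pos_of_mul_pos_right (h2.trans_le h1) hK.le
  -- The scaling `r` stays explicit: a fixed one for each `x` bounds `i_x ω`, and arbitrarily large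
  -- ones for `y - x` give the continuity of `η`.
  have hb : ∀ {r : ℝ} {x : V}, 0 < r → r • x ∈ N → ∀ y : V,
      |ω x y| ≤ r⁻¹ * √K * ‖FormSpace.of (energyForm ω D) c1 y‖ := by
    intro r x hr hx y
    have h1 := h _ hx y
    have h2 := FormSpace.norm_sq (energyForm ω D) c1 y
    rw [show energyForm ω D y y = ω (D y) y from rfl] at h2
    rw [← h2, map_smul, smul_eq_mul, ← halt.neg] at h1
    refine abs_le_of_sq_le_sq ?_ (by positivity)
    rw [mul_pow, mul_pow, Real.sq_sqrt hK.le, inv_pow, mul_assoc, inv_mul_eq_div,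
      le_div_iff₀ (by positivity)]
    linarith
  choose r hr hrN using habs
  let L : ∀ x : V, FormSpace (energyForm ω D) c1 →L[ℝ] ℝ := fun x =>
    LinearMap.mkContinuous (ω x ∘ₗ (FormSpace.of (energyForm ω D) c1).symm.toLinearMap)
      ((r x)⁻¹ * √K) (fun y => hb (hr x) (hrN x) _)
  -- `η x` is the Riesz representative of the extension of `i_x ω` to the completion.
  let η : V → FormSpace.HilbertCompletion (energyForm ω D) c1 := fun x =>
    (InnerProductSpace.toDual ℝ _).symm
      ((L x).extend (UniformSpace.Completion.toComplL (𝕜 := ℝ)))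
  have hη : ∀ x y : V, inner ℝ (η x) (FormSpace.toCompletion (energyForm ω D) c1 y) = ω x y := by
    intro x y
    rw [InnerProductSpace.toDual_symm_apply]
    exact (L x).extend_eq UniformSpace.Completion.denseRange_coe
      (UniformSpace.Completion.isUniformInducing_coe _) (FormSpace.of _ c1 y)
  refine ⟨c1, fun x => (L x).continuous, η, hη, ?_⟩
  rw [continuous_iff_continuousAt]
  intro x
  rw [ContinuousAt, tendsto_iff_norm_sub_tendsto_zero, Metric.tendsto_nhds]
  intro ε hε
  -- Chosen so that `R⁻¹ * √K ≤ ε / 2`; the summand `1` keeps a margin.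
  set R : ℝ := (√K + 1) / (ε / 2) with hR
  have hRpos : 0 < R := by positivity
  have hc : Tendsto (fun y : V => R • (y - x)) (𝓝 x) (𝓝 0) := by
    have : Continuous fun y : V => R • (y - x) := by fun_prop
    simpa using this.tendsto x
  filter_upwards [hc hN] with y hy
  have hle : ‖η y - η x‖ ≤ ε / 2 := by
    refine FormSpace.norm_le_of_inner_le _ _ _ (by positivity) fun w => ?_
    rw [inner_sub_left, hη, hη, ← LinearMap.sub_apply, ← map_sub]
    refine (le_abs_self _).trans ((hb hRpos hy w).trans ?_)
    rw [FormSpace.toCompletion, UniformSpace.Completion.norm_coe]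
    refine mul_le_mul_of_nonneg_right ?_ (norm_nonneg _)
    rw [hR, inv_div, div_mul_eq_mul_div, div_le_iff₀ (by positivity)]
    nlinarith [Real.sqrt_nonneg K]
  rw [dist_zero_right, norm_norm]
  linarith

end Form

/-! ### Coadjoint orbits in coordinates. -/

section Orbit

variable {V : Type*} [AddCommGroup V] [Module ℝ V] [TopologicalSpace V] {S : Datum V}

/-- This makes the energy form invariant under `γ`. -/
theorem Datum.D_γ [IsTopologicalAddGroup V] [ContinuousSMul ℝ V] [T2Space V] (t : ℝ) (x : V) :
    S.D (S.γ t x) = S.γ t (S.D x) := by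
  refine tendsto_nhds_unique (S.tendsto_D (S.γ t x))
    ((((S.γ t).continuous.tendsto _).comp (S.tendsto_D x)).congr fun s => ?_)
  simp only [Function.comp_apply, map_smul, map_sub, ← S.γ_add_apply, add_comm s t]

/-- A functional on the oscillator algebra in coordinates. -/
theorem OscAlgebra.dual_apply (α : OscAlgebra S →L[ℝ] ℝ) (x : OscAlgebra S) :
    α x = x.z * α (mk 1 0 0) + α (mk 0 x.v 0) + x.t * α (mk 0 0 1) := by
  have : x = x.z • mk 1 0 0 + mk 0 x.v 0 + x.t • mk 0 0 1 := by ext <;> simp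
  conv_lhs => rw [this]
  simp only [map_add, map_smul, smul_eq_mul]

/-- The restriction to `V` of a functional on the oscillator algebra. -/
def restrictV (α : OscAlgebra S →L[ℝ] ℝ) : V →L[ℝ] ℝ where
  toFun v := α (OscAlgebra.mk 0 v 0)
  map_add' v w := by
    rw [← map_add]
    congr 1
    ext <;> simp
  map_smul' c v := by
    rw [← map_smul]
    congr 1
    ext <;> simp
  cont := α.continuous.comp
    (OscAlgebra.continuous_mk continuous_const continuous_id continuous_const)

variable [IsTopologicalAddGroup V] [ContinuousSMul ℝ V] [T2Space V]

theorem dual_Ad (α : OscAlgebra S →L[ℝ] ℝ) (g : OscGroup S) (x : OscAlgebra S) :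
    α (Ad g x) =
      (x.z + S.ω g.v (S.γ g.t x.v) + (1 / 2) * x.t * S.ω (S.D g.v) g.v) * α (OscAlgebra.mk 1 0 0) +
        (restrictV α (S.γ g.t x.v) - x.t * restrictV α (S.D g.v)) +
        x.t * α (OscAlgebra.mk 0 0 1) := by
  rw [Ad_apply, OscAlgebra.dual_apply]
  simp only [OscAlgebra.z_mk, OscAlgebra.v_mk, OscAlgebra.t_mk]
  rw [← smul_eq_mul x.t (restrictV α _), ← (restrictV α).map_smul, ← (restrictV α).map_sub]
  rfl

theorem mem_coadjointOrbit {α β : OscAlgebra S →L[ℝ] ℝ} :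
    β ∈ coadjointOrbit α ↔ ∃ g : OscGroup S, ∀ x, β x = α (Ad g x) := by
  constructor
  · rintro ⟨g, rfl⟩
    exact ⟨g⁻¹, fun x => rfl⟩
  · rintro ⟨g, hg⟩
    refine ⟨g⁻¹, ?_⟩
    ext x
    change α (Ad g⁻¹⁻¹ x) = β x
    rw [inv_inv, hg]

theorem semiEquicontinuous_coadjointOrbit_iff (α : OscAlgebra S →L[ℝ] ℝ) :
    SemiEquicontinuous (coadjointOrbit α) ↔
      ∃ x₀ : OscAlgebra S, ∃ U ∈ 𝓝 x₀, ∃ C : ℝ, ∀ x ∈ U, ∀ g : OscGroup S, -α (Ad g x) ≤ C := by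
  have key : ∀ (x : OscAlgebra S) (C : ℝ), supportFunctional (coadjointOrbit α) x ≤ (C : EReal) ↔
      ∀ g : OscGroup S, -α (Ad g x) ≤ C := by
    intro x C
    simp only [supportFunctional, iSup_le_iff, EReal.coe_le_coe_iff]
    constructor
    · intro h g
      have := h (coAd g⁻¹ α) ⟨_, rfl⟩
      rw [coAd, inv_inv] at this
      simpa using this
    · intro h β hβ
      obtain ⟨g, hg⟩ := mem_coadjointOrbit.1 hβ
      rw [map_neg, hg]
      exact h g
  simp only [SemiEquicontinuous, key]

/-- If `α` vanishes on the center and on the range of `D`, its coadjoint orbit is trivial. -/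
theorem not_nontrivial_coadjointOrbit {α : OscAlgebra S →L[ℝ] ℝ}
    (hc : α (OscAlgebra.mk 1 0 0) = 0) (hD : ∀ w, restrictV α (S.D w) = 0) :
    ¬ (coadjointOrbit α).Nontrivial := by
  have hγ : ∀ (t : ℝ) (v : V), restrictV α (S.γ t v) = restrictV α v := by
    intro t v
    -- The derivative of `s ↦ α (γ s v)` is `α (D (γ s v))`, which vanishes by `hD`.
    have hder : ∀ s : ℝ, HasDerivAt (fun s => restrictV α (S.γ s v)) 0 s := by
      intro s
      have hlim := ((restrictV α).continuous.tendsto _).comp (S.tendsto_D (S.γ s v))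
      rw [hD] at hlim
      rw [hasDerivAt_iff_tendsto_slope_zero]
      refine hlim.congr fun h => ?_
      simp only [Function.comp_apply, map_smul, map_sub, ← S.γ_add_apply, add_comm s h]
    have := is_const_of_deriv_eq_zero (fun s => (hder s).differentiableAt)
      (fun s => (hder s).deriv) t 0
    simpa [S.γ_zero_apply] using this
  have hα : ∀ β ∈ coadjointOrbit α, β = α := by
    intro β hβ
    obtain ⟨g, hg⟩ := mem_coadjointOrbit.1 hβ
    ext x
    rw [hg, dual_Ad, hD, hγ, hc, OscAlgebra.dual_apply α x, hc]
    change _ + (α (OscAlgebra.mk 0 x.v 0) - _) + _ = _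
    ring
  rintro ⟨β, hβ, β', hβ', hne⟩
  exact hne ((hα β hβ).trans (hα β' hβ').symm)

/-! ### From a semi-equicontinuous orbit to the conditions. -/

/-- The discriminant inequality for the action of the Heisenberg group on a semi-equicontinuous
orbit. -/
theorem exists_sq_le_of_semiEquicontinuous {α : OscAlgebra S →L[ℝ] ℝ}
    (h : SemiEquicontinuous (coadjointOrbit α)) :
    ∃ (x : OscAlgebra S) (M : ℝ), x.t ≠ 0 ∧ 0 < M ∧ ∃ N ∈ 𝓝 (0 : V), ∀ n ∈ N, ∀ w : V,
      (α (OscAlgebra.mk 1 0 0) * S.ω w (x.v + n) - x.t * restrictV α (S.D w)) ^ 2 ≤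
        M * (x.t * α (OscAlgebra.mk 1 0 0) * S.ω (S.D w) w) := by
  obtain ⟨x₀, U', hU', C, hC'⟩ := (semiEquicontinuous_coadjointOrbit_iff α).1 h
  obtain ⟨U, hUU', hU, hx₀⟩ := mem_nhds_iff.1 hU'
  have hC : ∀ x ∈ U, ∀ g : OscGroup S, -α (Ad g x) ≤ C := fun x hx => hC' x (hUU' hx)
  obtain ⟨x, hxU, hxt⟩ : ∃ x ∈ U, x.t ≠ 0 := by
    -- The hyperplane `t = 0` has empty interior, so the open set `U` contains a point off it.
    by_cases h0 : x₀.t = 0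
    · have hc : Tendsto (fun s : ℝ => x₀ + s • (OscAlgebra.mk 0 0 1 : OscAlgebra S)) (𝓝[≠] 0)
          (𝓝 x₀) := by
        have : Continuous fun s : ℝ => x₀ + s • (OscAlgebra.mk 0 0 1 : OscAlgebra S) := by
          fun_prop
        simpa using (this.tendsto 0).mono_left (nhdsWithin_le_nhds (s := {0}ᶜ))
      obtain ⟨s, hs, hs'⟩ := ((hc.eventually (hU.mem_nhds hx₀)).and self_mem_nhdsWithin).exists
      refine ⟨_, hs, ?_⟩
      simpa [h0] using hs'
    · exact ⟨x₀, hx₀, h0⟩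
  have hN1 : ∀ᶠ n in 𝓝 (0 : V), x + OscAlgebra.mk 0 n 0 ∈ U := by
    have hc : Continuous fun n : V => x + (OscAlgebra.mk 0 n 0 : OscAlgebra S) :=
      continuous_const.add
        (OscAlgebra.continuous_mk continuous_const continuous_id continuous_const)
    refine hc.tendsto 0 (hU.mem_nhds ?_)
    have : (OscAlgebra.mk 0 0 0 : OscAlgebra S) = 0 := rfl
    rwa [this, add_zero]
  have hN2 : ∀ᶠ n in 𝓝 (0 : V), restrictV α n < 1 :=
    (restrictV α).continuous.tendsto 0 (gt_mem_nhds (by simp))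
  set A : ℝ := C + x.z * α (OscAlgebra.mk 1 0 0) + restrictV α x.v +
    x.t * α (OscAlgebra.mk 0 0 1) with hA
  refine ⟨x, 2 * (|A| + 1), hxt, by positivity, _, hN1.and hN2, fun n hn w => ?_⟩
  -- The polynomial in `r` is `C + α (Ad g (x + n))` for `g = (0, r • w, 0)`. Its constant term `A +
  -- α n` is enlarged to `|A| + 1`, which does not depend on `n`.
  have hdis := discrim_le_zero (a := (1 / 2) * (x.t * α (OscAlgebra.mk 1 0 0) * S.ω (S.D w) w))
    (b := α (OscAlgebra.mk 1 0 0) * S.ω w (x.v + n) - x.t * restrictV α (S.D w))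
    (c := |A| + 1) fun r => ?_
  · rw [discrim] at hdis
    linarith
  · have h1 := hC _ hn.1 ⟨0, r • w, 0⟩
    have h2 : restrictV α n < 1 := hn.2
    rw [dual_Ad] at h1
    simp only [S.γ_zero_apply, OscAlgebra.z_add, OscAlgebra.v_add, OscAlgebra.t_add,
      OscAlgebra.z_mk, OscAlgebra.v_mk, OscAlgebra.t_mk, map_smul, map_add, LinearMap.smul_apply,
      smul_eq_mul, add_zero] at h1
    rw [map_add]
    linarith [le_abs_self A]

/-- The linear coefficients at `n` and at `0` differ by `c * ω w n`, so the two discriminant bounds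
control `ω w n`; the sign of `x.t / c` selects the alternative. -/
theorem charConditions_of_orbit {α : OscAlgebra S →L[ℝ] ℝ}
    (hnt : (coadjointOrbit α).Nontrivial) (h : SemiEquicontinuous (coadjointOrbit α)) :
    CharConditions S.ω S.D ∨ CharConditions S.ω (-S.D) := by
  obtain ⟨x, M, hxt, hM, N, hN, hle⟩ := exists_sq_le_of_semiEquicontinuous h
  set c := α (OscAlgebra.mk 1 0 0) with hc
  -- For `c = 0` the inequality reads `(x.t * α (D w)) ^ 2 ≤ 0`, so `α` also vanishes on the range
  -- of `D`.
  have hc0 : c ≠ 0 := by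
    intro h0
    refine not_nontrivial_coadjointOrbit h0 (fun w => ?_) hnt
    have h1 := hle 0 (mem_of_mem_nhds hN) w
    rw [h0] at h1
    have h2 : (x.t * restrictV α (S.D w)) ^ 2 ≤ 0 := by linarith
    have h3 := pow_eq_zero_iff two_ne_zero |>.1 (le_antisymm h2 (sq_nonneg _))
    exact (mul_eq_zero.1 h3).resolve_left hxt
  have hb : ∀ n ∈ N, ∀ w, S.ω w n ^ 2 ≤ 4 * M * (x.t / c) * S.ω (S.D w) w := by
    intro n hn w
    have h1 := hle n hn w
    have h0 := hle 0 (mem_of_mem_nhds hN) w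
    rw [add_zero] at h0
    rw [map_add] at h1
    have h2 : c ^ 2 * S.ω w n ^ 2 ≤ c ^ 2 * (4 * M * (x.t / c) * S.ω (S.D w) w) := by
      have e : c ^ 2 * (4 * M * (x.t / c) * S.ω (S.D w) w) =
          4 * (M * (x.t * c * S.ω (S.D w) w)) := by field_simp
      rw [e]
      -- This is `(a - b) ^ 2 ≤ 2 * a ^ 2 + 2 * b ^ 2`, equivalent to `0 ≤ (a + b) ^ 2`.
      nlinarith [sq_nonneg (c * (S.ω w x.v + S.ω w n) - x.t * restrictV α (S.D w) +
        (c * S.ω w x.v - x.t * restrictV α (S.D w)))]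
    exact le_of_mul_le_mul_left h2 (by positivity)
  rcases (div_ne_zero hxt hc0).lt_or_gt with hneg | hpos
  · refine .inr (charConditions_of_bound S.ω (-S.D) S.isAlt_ω S.nondegenerate_ω (fun x y => ?_) hN
      (K := 4 * M * -(x.t / c)) (by have := neg_pos.2 hneg; positivity) fun n hn w => ?_)
    · simp [S.ω_D_left]
    · refine (hb n hn w).trans_eq ?_
      simp
  · exact .inl (charConditions_of_bound S.ω S.D S.isAlt_ω S.nondegenerate_ω S.ω_D_left hN
      (K := 4 * M * (x.t / c)) (by positivity) hb)

/-! ### The orbit of the central functional. -/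

/-- The projection onto the center. -/
def centralFunctional (S : Datum V) : OscAlgebra S →L[ℝ] ℝ where
  toFun x := x.z
  map_add' _ _ := rfl
  map_smul' _ _ := rfl
  cont := OscAlgebra.continuous_z

theorem centralFunctional_Ad (g : OscGroup S) (x : OscAlgebra S) :
    centralFunctional S (Ad g x) =
      x.z + S.ω g.v (S.γ g.t x.v) + (1 / 2) * x.t * S.ω (S.D g.v) g.v := by
  rw [Ad_apply]
  rfl

theorem nontrivial_orbit_centralFunctional [Nontrivial V] (S : Datum V) :
    (coadjointOrbit (centralFunctional S)).Nontrivial := by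
  obtain ⟨w, hw⟩ := exists_ne (0 : V)
  obtain ⟨v, hv⟩ : ∃ v, S.ω w v ≠ 0 := by
    by_contra! h
    exact hw (S.nondegenerate_ω.1 w h)
  refine ⟨_, ⟨(⟨0, w, 0⟩ : OscGroup S)⁻¹, rfl⟩, _, ⟨(1 : OscGroup S)⁻¹, rfl⟩, fun h => hv ?_⟩
  have h1 := DFunLike.congr_fun h (OscAlgebra.mk 0 v 0)
  simp only [coAd, inv_inv, ContinuousLinearMap.comp_apply, centralFunctional_Ad] at h1
  simpa [S.γ_zero_apply, OscGroup.one_def] using h1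

/-- The sign `ε = ±1` treats `D` and `-D` together. Near `(0, 0, ε)` the factor `ε * x.t` stays
above `1 / 2`, so the energy term dominates the linear one. -/
theorem semiEquicontinuous_orbit_centralFunctional {D : V →L[ℝ] V} {ε : ℝ} (hε : ε * ε = 1)
    (hD : ∀ x, S.D x = ε • D x) (h : CharConditions S.ω D) :
    SemiEquicontinuous (coadjointOrbit (centralFunctional S)) := by
  rw [semiEquicontinuous_coadjointOrbit_iff]
  obtain ⟨c1, -, η, hη, hηc⟩ := h
  set K := ‖η 0‖ + 1 with hK
  have h1 : ∀ᶠ x : OscAlgebra S in 𝓝 (OscAlgebra.mk 0 0 ε), ‖η x.v‖ < K :=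
    ((hηc.norm.comp OscAlgebra.continuous_v).tendsto (OscAlgebra.mk 0 0 ε : OscAlgebra S))
      (gt_mem_nhds (by simp [hK]))
  have h2 : ∀ᶠ x : OscAlgebra S in 𝓝 (OscAlgebra.mk 0 0 ε), (1 / 2 : ℝ) < ε * x.t :=
    ((continuous_const.mul OscAlgebra.continuous_t).tendsto
      (OscAlgebra.mk 0 0 ε : OscAlgebra S)) (lt_mem_nhds (by simp [hε]; norm_num))
  have h3 : ∀ᶠ x : OscAlgebra S in 𝓝 (OscAlgebra.mk 0 0 ε), -1 < x.z :=
    (OscAlgebra.continuous_z.tendsto (OscAlgebra.mk 0 0 ε : OscAlgebra S))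
      (lt_mem_nhds (by simp))
  refine ⟨_, _, h1.and (h2.and h3), 1 + K ^ 2, ?_⟩
  rintro x ⟨hx1, hx2, hx3⟩ g
  -- Since `γ` preserves `ω` and commutes with `D`, both terms can be expressed through `w`, leaving
  -- `x.v` untransformed.
  set w := S.γ (-g.t) g.v with hw
  have e1 : S.ω g.v (S.γ g.t x.v) = -S.ω x.v w := by
    rw [← S.γ_symp (-g.t), S.γ_cancel_neg, S.ω_swap]
  have e2 : S.ω (S.D g.v) g.v = ε * energyForm S.ω D w w := by
    rw [← S.γ_symp (-g.t), ← Datum.D_γ, ← hw, hD, map_smul]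
    rfl
  rw [centralFunctional_Ad, e1, e2, ← FormSpace.norm_toCompletion_sq _ c1, ← hη]
  set q := ‖FormSpace.toCompletion (energyForm S.ω D) c1 w‖ with hq
  have hq0 : 0 ≤ q := norm_nonneg _
  have h4 := (real_inner_le_norm (η x.v) (FormSpace.toCompletion (energyForm S.ω D) c1 w)).trans
    (mul_le_mul_of_nonneg_right hx1.le hq0)
  have h5 : (1 / 2) * q ^ 2 ≤ ε * x.t * q ^ 2 := by gcongr
  -- Completing the square: `K * q - q ^ 2 / 4 ≤ K ^ 2`, while `-x.z < 1`.
  nlinarith [sq_nonneg (q / 2 - K)]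

end Orbit

end Oscillator

theorem mainTheorem3 {V : Type*} [AddCommGroup V] [Module ℝ V] [TopologicalSpace V]
    [IsTopologicalAddGroup V] [ContinuousSMul ℝ V] [LocallyConvexSpace ℝ V] [T2Space V]
    [Nontrivial V] (S : Oscillator.Datum V) :
    (∃ α : Oscillator.OscAlgebra S →L[ℝ] ℝ,
        (Oscillator.coadjointOrbit α).Nontrivial ∧
        Oscillator.SemiEquicontinuous (Oscillator.coadjointOrbit α)) ↔
      (Oscillator.CharConditions S.ω S.D ∨ Oscillator.CharConditions S.ω (-S.D)) := by
  constructor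
  · rintro ⟨α, hnt, h⟩
    exact Oscillator.charConditions_of_orbit hnt h
  · refine fun h => ⟨Oscillator.centralFunctional S,
      Oscillator.nontrivial_orbit_centralFunctional S, ?_⟩
    rcases h with h | h
    · exact Oscillator.semiEquicontinuous_orbit_centralFunctional (ε := 1) (by norm_num)
        (fun x => by simp) h
    · exact Oscillator.semiEquicontinuous_orbit_centralFunctional (ε := -1) (by norm_num)
        (fun x => by simp) h
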